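/- Let $l=(l(t))_{t\ge 0}$ be a real-valued Lévy process (that is, $l(0)=0$ a.s., with independent and stationary increments, stochastically continuous) on a probability space $(\Omega,\mathcal F,\mathbb P)$. Let $W=(W(x))_{x\in\mathcal D}$, $\mathcal D\subset\mathbb R^d$, be a Gaussian random field that is independent of $l$, and let $F:\mathbb R\to[0,\infty)$ be measurable. (1) Let $C\in(0,\infty]$ with $F(y)<C$ for all $y$, let $l^{(\varepsilon_l)}$ (an approximation of $l$) be a process whose paths are a.s. càdlàg on $[0,C)$, and let $W^N=(W^N(x))_{x\in\mathcal D}$ (an approximation of $W$) be a random field independent of $l^{(\varepsilon_l)}$. Then for all $x\in\mathcal D$ and $\xi\in\mathbb R$, $$\phi_{l^{(\varepsilon_l)}(F(W^N(x)))}(\xi)=\mathbb E\big(\exp(i\xi\, l^{(\varepsilon_l)}(F(W^N(x))))\big)=\mathbb E\big(\rho_{l^{(\varepsilon_l)}}(F(W^N(x)),\xi)\big),\qquad \rho_{l^{(\varepsilon_l)}}(t,\xi):=\mathbb E\big(\exp(i\xi\, l^{(\varepsilon_l)}(t))\big).$$ (2) Let $l$ have Lévy triplet $(\gamma,b,\nu)$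 and characteristic exponent $$\psi(\xi)=i\gamma\xi-\frac b2\xi^2+\int_{\mathbb R\setminus\{0\}}\big(e^{i\xi y}-1-i\xi y\mathbf 1_{\{|y|\le1\}}\big)\,\nu(dy),$$ where $b\ge0$, $\int\min(y^2,1)\,\nu(dy)<\infty$ and the characteristic function of $l(1)$ is $e^{\psi}$. Let $\mathcal D$ be compact and $W$ mean-square continuous with mean function $\mu_W$ and covariance operator $Q$ on $L^2(\mathcal D)$. Let $(e_i)_{i\ge1}$ be an orthonormal basis of $L^2(\mathcal D)$ with $Qe_i=\lambda_ie_i$, $\lambda_i\ge0$, and let $(Z_i)_{i\ge1}$ be i.i.d. standard normal random variables such that $W(x)=\mu_W(x)+\sum_{i\ge1}\sqrt{\lambda_i}Z_ie_i(x)$ in mean square for every $x\in\mathcal D$. Let $C_F$ satisfy $F(y)<C_F$ for all $y$, let $\varepsilon_l>0$, and let $0=t_0<t_1<\dots<t_{N_l}=C_F$ with $t_{i+1}-t_i=\varepsilon_l$ for $i=0,\dots,N_l-1$. Put $$l^{(\varepsilon_l)}(t)=\sum_{i=1}^{N_l}\mathbf 1_{[t_{i-1},t_i)}(t)\,l(t_{i-1}),\qquad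 W^N(x)=\mu_W(x)+\sum_{i=1}^N\sqrt{\lambda_i}Z_ie_i(x).$$ Then for every $N$ and $x\in\mathcal D$, $$\sigma_{W,N}^2(x):=\mathrm{Var}(W^N(x))=\mathbb E\Big(\sum_{i=1}^N\sqrt{\lambda_i}Z_ie_i(x)\Big)^2=\sum_{i=1}^N\lambda_ie_i(x)^2,$$ the identity of (1) holds for these $l^{(\varepsilon_l)}$ and $W^N$, and for every $\xi\in\mathbb R$ $$\phi_{l^{(\varepsilon_l)}(F(W^N(x)))}(\xi)=\int_{\mathbb R}\exp\big(t_{\lfloor F(y)/\varepsilon_l\rfloor}\psi(\xi)\big)\,\mathcal N\big(\mu_W(x),\sigma_{W,N}^2(x)\big)(dy),$$ where $\mathcal N(\mu,\sigma^2)$ is the normal law with mean $\mu$ and variance $\sigma^2$ (the Dirac measure at $\mu$ if $\sigma^2=0$). If $\sigma_{W,N}^2(x)>0$, this reads $$\phi_{l^{(\varepsilon_l)}(F(W^N(x)))}(\xi)=\frac1{\sqrt{2\pi\sigma_{W,N}^2(x)}}\int_{\mathbb R}\exp\Big(t_{\lfloor F(y)/\varepsilon_l\rfloor}\psi(\xi)-\frac{(y-\mu_W(x))^2}{2\sigma_{W,N}^2(x)}\Big)dy.$$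 -/

import Mathlib

open MeasureTheory ProbabilityTheory Filter Topology Complex
open scoped NNReal ENNReal

noncomputable section

namespace GSLF

variable {Ω : Type*} [MeasurableSpace Ω]

/-- A real-valued Lévy process `(l t)`, `t ≥ 0`: it starts at `0` almost surely, has independent and
stationary increments, and is stochastically continuous. -/
structure IsLevyProcess (l : ℝ≥0 → Ω → ℝ) (P : Measure Ω) : Prop where
  measurable : ∀ t, Measurable (l t)
  zero : ∀ᵐ ω ∂P, l 0 ω = 0
  indep_increments : HasIndepIncrements l P
  stationary_increments : ∀ s t : ℝ≥0, s ≤ t →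
    IdentDistrib (fun ω => l t ω - l s ω) (l (t - s)) P P
  stochastically_continuous : ∀ s : ℝ≥0, TendstoInMeasure P l (𝓝 s) (l s)

/-- The characteristic exponent
`ψ(ξ) = iγξ - (b/2) ξ² + ∫_{ℝ∖{0}} (e^{iξy} - 1 - iξy 1_{|y| ≤ 1}) ν(dy)`. -/
def charExponent (γ : ℝ) (b : ℝ≥0) (ν : Measure ℝ) (ξ : ℝ) : ℂ :=
  I * γ * ξ - (b : ℂ) / 2 * (ξ : ℂ) ^ 2
    + ∫ y in ({0}ᶜ : Set ℝ),
        (cexp (I * ξ * y) - 1 - I * ξ * y * (if |y| ≤ 1 then 1 else 0)) ∂ν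

/-- `(γ, b, ν)` is the Lévy triplet of the process `l`: the measure `ν` integrates `min (y², 1)`, and
the law of `l 1` has the characteristic function `exp ψ`, with `ψ` the exponent built from
`(γ, b, ν)`. (The formula `exp (t ψ)` at the other times `t` is not part of the definition.) -/
structure HasLevyTriplet (l : ℝ≥0 → Ω → ℝ) (P : Measure Ω)
    (γ : ℝ) (b : ℝ≥0) (ν : Measure ℝ) : Prop where
  levyMeasure : Integrable (fun y : ℝ => min (y ^ 2) 1) ν
  charFun_one : ∀ ξ : ℝ, charFun (P.map (l 1)) ξ = cexp (charExponent γ b ν ξ)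

/-- Right-continuous with left limits on the interval `[0, C)`, where `C ≤ ∞`. -/
def IsCadlagBefore (C : ℝ≥0∞) (f : ℝ≥0 → ℝ) : Prop :=
  ∀ t : ℝ≥0, (t : ℝ≥0∞) < C →
    ContinuousWithinAt f (Set.Ioi t) t ∧ ∃ L : ℝ, Tendsto f (𝓝[<] t) (𝓝 L)

/-- Stochastic independence of two families of random variables, as families. -/
def IndepFamilies {S T : Type*} (X : S → Ω → ℝ) (Y : T → Ω → ℝ) (P : Measure Ω) : Prop :=
  IndepFun (fun ω s => X s ω) (fun ω t => Y t ω) P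

/-- The piecewise constant extension of the values of `l` on the grid `t 0, …, t n`:
`s ↦ ∑_{i=1}^{n} 1_{[t (i-1), t i)}(s) l(t (i-1))`. -/
def piecewiseConst (l : ℝ≥0 → Ω → ℝ) (t : ℕ → ℝ≥0) (n : ℕ) (s : ℝ≥0) (ω : Ω) : ℝ :=
  ∑ i ∈ Finset.range n, (Set.Ico (t i) (t (i + 1))).indicator (fun _ => l (t i) ω) s

section Field

variable {d : ℕ} {D : Set (EuclideanSpace ℝ (Fin d))}

/-- A Gaussian random field on `D`. -/
structure IsGaussianField (W : D → Ω → ℝ) (P : Measure Ω) : Prop where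
  measurable : ∀ x, Measurable (W x)
  gaussian : IsGaussianProcess W P

/-- Mean-square continuity of a random field. -/
def IsMeanSquareContinuous (W : D → Ω → ℝ) (P : Measure Ω) : Prop :=
  ∀ x, Tendsto (fun y => eLpNorm (fun ω => W y ω - W x ω) 2 P) (𝓝 x) (𝓝 0)

/-- The mean function of a random field. -/
def meanFun (W : D → Ω → ℝ) (P : Measure Ω) (x : D) : ℝ := ∫ ω, W x ω ∂P

/-- The covariance function of a random field. -/
def covFun (W : D → Ω → ℝ) (P : Measure Ω) (x y : D) : ℝ :=
  ∫ ω, (W x ω - meanFun W P x) * (W y ω - meanFun W P y) ∂P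

/-- Lebesgue measure on `D`. -/
abbrev volOn (D : Set (EuclideanSpace ℝ (Fin d))) : Measure D :=
  (volume : Measure (EuclideanSpace ℝ (Fin d))).comap Subtype.val

/-- The covariance operator `(Q f)(x) = ∫_D q(x, y) f(y) dy`. -/
def covOp (W : D → Ω → ℝ) (P : Measure Ω) (f : D → ℝ) (x : D) : ℝ :=
  ∫ y, covFun W P x y * f y ∂(volOn D)

/-- `(lam i, e i)`, `i = 0, 1, …`, are eigenpairs of the covariance operator of `W`, and the `e i`
form an orthonormal basis of `L²(D)`. -/
structure IsCovEigenbasis (W : D → Ω → ℝ) (P : Measure Ω) (lam : ℕ → ℝ) (e : ℕ → D → ℝ) :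
    Prop where
  nonneg : ∀ i, 0 ≤ lam i
  memLp : ∀ i, MemLp (e i) 2 (volOn D)
  orthonormal : Orthonormal ℝ (fun i => (memLp i).toLp (e i))
  complete : (Submodule.span ℝ (Set.range fun i => (memLp i).toLp (e i))).topologicalClosure = ⊤
  eigen : ∀ i, covOp W P (e i) =ᵐ[volOn D] fun x => lam i * e i x

/-- The truncated Karhunen–Loève sum `∑_{i=1}^N √λ_i Z_i e_i(x)`, indexed from `0`. -/
def klSum (lam : ℕ → ℝ) (e : ℕ → D → ℝ) (Z : ℕ → Ω → ℝ) (N : ℕ) (x : D) (ω : Ω) : ℝ :=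
  ∑ i ∈ Finset.range N, √(lam i) * Z i ω * e i x

/-- `W(x) = μ_W(x) + ∑_{i ≥ 1} √λ_i Z_i e_i(x)` for every `x`, in mean square, with independent
standard normal `Z_i`, where `(λ_i, e_i)` is an eigenbasis of the covariance operator of `W`. -/
structure IsKarhunenLoeve (W : D → Ω → ℝ) (P : Measure Ω) (lam : ℕ → ℝ) (e : ℕ → D → ℝ)
    (Z : ℕ → Ω → ℝ) : Prop where
  eigenbasis : IsCovEigenbasis W P lam e
  measurable : ∀ i, Measurable (Z i)
  indep : iIndepFun Z P
  law : ∀ i, P.map (Z i) = gaussianReal 0 1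
  expansion : ∀ x, Tendsto
    (fun n => eLpNorm (fun ω => W x ω - (meanFun W P x + klSum lam e Z n x ω)) 2 P) atTop (𝓝 0)

/-- The truncated expansion `W^N(x) = μ_W(x) + ∑_{i=1}^N √λ_i Z_i e_i(x)`. -/
def truncKL (W : D → Ω → ℝ) (P : Measure Ω) (lam : ℕ → ℝ) (e : ℕ → D → ℝ) (Z : ℕ → Ω → ℝ)
    (N : ℕ) (x : D) (ω : Ω) : ℝ :=
  meanFun W P x + klSum lam e Z N x ω

/-- The variance function `σ²_{W,N}(x) = ∑_{i=1}^N λ_i e_i(x)²`. -/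
def klVar (lam : ℕ → ℝ) (e : ℕ → D → ℝ) (N : ℕ) (x : D) : ℝ :=
  ∑ i ∈ Finset.range N, lam i * e i x ^ 2

/-- `l(F(W(x)))`: the process `l` subordinated by the nonnegative transformation `F` of `W`. -/
def subordField (l : ℝ≥0 → Ω → ℝ) (F : ℝ → ℝ≥0) (W : D → Ω → ℝ) (x : D) (ω : Ω) : ℝ :=
  l (F (W x ω)) ω

end Field

end GSLF

end

open GSLF

/-! Both claims come from freezing the independent random time `T = F(W^N(x))`. Evaluating a path at
a point is not jointly measurable on the product σ-algebra, so `T` is replaced by grid times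
decreasing to it. At these, evaluation is measurable and Fubini applies to the product law of path
and time; right-continuity and dominated convergence then give the limit (`charFun_randomTime`).

The explicit formula needs three more facts. The law of `l t` has characteristic function `exp (t
ψ)`, although this is assumed only at `t = 1` (`HasLevyTriplet.charFun_eq`). `W^N(x)` is normal
(`map_truncKL`). Finally, `l` is independent of `W^N`, although only independence of `l` and `W` is
given: each `√λ_i Z_i` must be recovered from `W` (`smul_mem_of_orthonormal_expansion`). If `V` in
`L²(P)` is orthogonal to the `W`-measurable variables, then `∑ √λ_j ⟨V, Z_j⟩ e_j(x) = 0` for every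
`x`; integrating against `e_i` gives `√λ_i ⟨V, Z_i⟩ = 0`. -/

/-- The smallest point of the grid `ℕ / (n + 1)` strictly to the right of `s`. -/
noncomputable def gridRight (n : ℕ) (s : ℝ≥0) : ℝ≥0 := (⌊((n : ℝ≥0) + 1) * s⌋₊ + 1) / (n + 1)

lemma lt_gridRight (n : ℕ) (s : ℝ≥0) : s < gridRight n s := by
  rw [gridRight, lt_div_iff₀ (by positivity), mul_comm]
  exact Nat.lt_floor_add_one _

lemma gridRight_le (n : ℕ) (s : ℝ≥0) : gridRight n s ≤ s + 1 / (n + 1) := by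
  rw [gridRight, add_div]
  gcongr
  rw [div_le_iff₀ (by positivity), mul_comm]
  exact Nat.floor_le (by positivity)

lemma tendsto_gridRight (s : ℝ≥0) : Tendsto (fun n => gridRight n s) atTop (𝓝[>] s) := by
  refine tendsto_nhdsWithin_iff.2 ⟨?_, Eventually.of_forall fun n => lt_gridRight n s⟩
  refine tendsto_of_tendsto_of_tendsto_of_le_of_le tendsto_const_nhds ?_
    (fun n => (lt_gridRight n s).le) (fun n => gridRight_le n s)
  have h : Tendsto (fun n : ℕ => (1 : ℝ≥0) / (n + 1)) atTop (𝓝 0) := by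
    rw [← NNReal.tendsto_coe]
    simpa using tendsto_one_div_add_atTop_nhds_zero_nat (𝕜 := ℝ)
  simpa using tendsto_const_nhds.add h

/-! ### Processes at an independent random time -/

section RandomTime

variable {Ω : Type*} [MeasurableSpace Ω] {P : Measure Ω}

lemma charFun_map_eq_integral_cexp {Y : Ω → ℝ} (hY : AEMeasurable Y P) (ξ : ℝ) :
    charFun (P.map Y) ξ = ∫ ω, cexp (I * ξ * Y ω) ∂P := by
  rw [charFun_apply_real, integral_map hY (by fun_prop)]
  refine integral_congr_ae (Eventually.of_forall fun ω => ?_)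
  dsimp only
  congr 1
  ring

lemma norm_cexp_I_mul_mul (x y : ℝ) : ‖cexp (I * x * y)‖ = 1 := by
  rw [show I * (x : ℂ) * y = ((x * y : ℝ) : ℂ) * I by push_cast; ring, norm_exp_ofReal_mul_I]

/-- The grid time depends on `s` only through a natural number, so countably many coordinate maps
are glued. -/
lemma measurable_eval_gridRight (n : ℕ) :
    Measurable fun p : (ℝ≥0 → ℝ) × ℝ≥0 => p.1 (gridRight n p.2) := by
  have h : Measurable fun q : (ℝ≥0 → ℝ) × ℕ => q.1 (((q.2 : ℝ≥0) + 1) / (n + 1)) :=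
    measurable_from_prod_countable_left fun k =>
      measurable_pi_apply (((k : ℝ≥0) + 1) / (n + 1))
  have h2 : Measurable fun p : (ℝ≥0 → ℝ) × ℝ≥0 => (p.1, ⌊((n : ℝ≥0) + 1) * p.2⌋₊) :=
    measurable_fst.prodMk (Nat.measurable_floor.comp (measurable_snd.const_mul _))
  exact h.comp h2

lemma measurable_comp_gridRight {β : Type*} [MeasurableSpace β] (n : ℕ) (f : ℝ≥0 → β) :
    Measurable fun s => f (gridRight n s) :=
  (measurable_from_nat (f := fun k : ℕ => f (((k : ℝ≥0) + 1) / (n + 1)))).comp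
    (Nat.measurable_floor.comp (measurable_id.const_mul ((n : ℝ≥0) + 1)))

variable [IsProbabilityMeasure P] {X : ℝ≥0 → Ω → ℝ} {T : Ω → ℝ≥0}

lemma integral_cexp_gridRight (hX : ∀ t, Measurable (X t)) (hT : Measurable T)
    (hXT : IndepFun (fun ω t => X t ω) T P) (n : ℕ) (ξ : ℝ) :
    ∫ ω, cexp (I * ξ * X (gridRight n (T ω)) ω) ∂P
      = ∫ ω, charFun (P.map (X (gridRight n (T ω)))) ξ ∂P := by
  have hX' : Measurable fun ω t => X t ω := measurable_pi_lambda _ hX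
  have hprod := hXT.map_prod_eq_prod_map_map hX'.aemeasurable hT.aemeasurable
  have hm : Measurable fun p : (ℝ≥0 → ℝ) × ℝ≥0 => cexp (I * ξ * p.1 (gridRight n p.2)) :=
    ((continuous_ofReal.measurable.comp (measurable_eval_gridRight n)).const_mul _).cexp
  have : IsProbabilityMeasure (P.map fun ω t => X t ω) :=
    Measure.isProbabilityMeasure_map hX'.aemeasurable
  have : IsProbabilityMeasure (P.map T) := Measure.isProbabilityMeasure_map hT.aemeasurable
  have h1 : ∫ ω, cexp (I * ξ * X (gridRight n (T ω)) ω) ∂P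
      = ∫ p, cexp (I * ξ * p.1 (gridRight n p.2)) ∂(P.map fun ω => (fun t => X t ω, T ω)) :=
    (integral_map (hX'.prodMk hT).aemeasurable hm.aestronglyMeasurable).symm
  rw [h1, hprod, integral_prod_symm _ (Integrable.of_bound hm.aestronglyMeasurable 1
    (Eventually.of_forall fun p => (norm_cexp_I_mul_mul _ _).le)),
    integral_map hT.aemeasurable]
  · refine integral_congr_ae (Eventually.of_forall fun ω => ?_)
    dsimp only
    rw [charFun_map_eq_integral_cexp (hX _).aemeasurable, integral_map hX'.aemeasurable]
    exact (hm.comp (measurable_id.prodMk measurable_const)).aestronglyMeasurable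
  · exact hm.stronglyMeasurable.integral_prod_left'.aestronglyMeasurable

/-- A process with right-continuous paths, evaluated at an independent random time. -/
theorem charFun_randomTime (hX : ∀ t, Measurable (X t)) (hT : Measurable T)
    (hXT : IndepFun (fun ω t => X t ω) T P)
    (hrc : ∀ᵐ ω ∂P, ∀ ω', ContinuousWithinAt (fun t => X t ω) (Set.Ioi (T ω')) (T ω')) :
    AEMeasurable (fun ω => X (T ω) ω) P ∧ ∀ ξ : ℝ,
      Integrable (fun ω => charFun (P.map (X (T ω))) ξ) P ∧
      ∫ ω, cexp (I * ξ * X (T ω) ω) ∂P = ∫ ω, charFun (P.map (X (T ω))) ξ ∂P := by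
  have hlim : ∀ᵐ ω ∂P, ∀ ω', Tendsto (fun n => X (gridRight n (T ω')) ω) atTop
      (𝓝 (X (T ω') ω)) := by
    filter_upwards [hrc] with ω hω ω'
    exact (hω ω').tendsto.comp (tendsto_gridRight _)
  have hmeas : ∀ n, Measurable fun ω => X (gridRight n (T ω)) ω := fun n =>
    (measurable_eval_gridRight n).comp ((measurable_pi_lambda _ hX).prodMk hT)
  refine ⟨aemeasurable_of_tendsto_metrizable_ae atTop (fun n => (hmeas n).aemeasurable)
    (hlim.mono fun ω h => h ω), fun ξ => ?_⟩
  have hc : Continuous fun y : ℝ => cexp (I * ξ * y) := by fun_prop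
  have hφ : ∀ ω', Tendsto (fun n => charFun (P.map (X (gridRight n (T ω')))) ξ) atTop
      (𝓝 (charFun (P.map (X (T ω'))) ξ)) := by
    intro ω'
    -- The time `T ω'` is now deterministic; the null set in `hlim` does not depend on `ω'`.
    simp_rw [charFun_map_eq_integral_cexp (hX _).aemeasurable]
    refine tendsto_integral_of_dominated_convergence (fun _ => 1)
      (fun n => (hc.measurable.comp (hX _)).aestronglyMeasurable) (integrable_const _)
      (fun n => Eventually.of_forall fun ω => (norm_cexp_I_mul_mul _ _).le) ?_
    filter_upwards [hlim] with ω hω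
    exact (hc.tendsto _).comp (hω ω')
  have hφm : ∀ n, Measurable fun ω => charFun (P.map (X (gridRight n (T ω)))) ξ := fun n =>
    (measurable_comp_gridRight n fun s => charFun (P.map (X s)) ξ).comp hT
  have hφ1 : ∀ s, ‖charFun (P.map (X s)) ξ‖ ≤ 1 := fun s => by
    have := Measure.isProbabilityMeasure_map (μ := P) (hX s).aemeasurable
    exact norm_charFun_le_one ξ
  -- Measurability of the integrand is inherited from the grid approximations.
  refine ⟨Integrable.of_bound (measurable_of_tendsto_metrizable hφm
    (tendsto_pi_nhds.2 hφ)).aestronglyMeasurable 1 (Eventually.of_forall fun ω => hφ1 _), ?_⟩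
  refine tendsto_nhds_unique (f := fun n => ∫ ω, cexp (I * ξ * X (gridRight n (T ω)) ω) ∂P)
    (l := atTop) ?_ ?_
  · refine tendsto_integral_of_dominated_convergence (fun _ => 1)
      (fun n => (hc.measurable.comp (hmeas n)).aestronglyMeasurable) (integrable_const _)
      (fun n => Eventually.of_forall fun ω => (norm_cexp_I_mul_mul _ _).le) ?_
    filter_upwards [hlim] with ω hω
    exact (hc.tendsto _).comp (hω ω)
  · simp_rw [integral_cexp_gridRight hX hT hXT]
    exact tendsto_integral_of_dominated_convergence (fun _ => 1)
      (fun n => (hφm n).aestronglyMeasurable) (integrable_const _)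
      (fun n => Eventually.of_forall fun ω => hφ1 _) (Eventually.of_forall hφ)

end RandomTime

/-! ### Characteristic functions of a Lévy process -/

section Levy

variable {Ω : Type*} [MeasurableSpace Ω] {P : Measure Ω} [IsProbabilityMeasure P]
  {l : ℝ≥0 → Ω → ℝ}

lemma GSLF.IsLevyProcess.charFun_zero (hl : IsLevyProcess l P) (ξ : ℝ) :
    charFun (P.map (l 0)) ξ = 1 := by
  rw [charFun_map_eq_integral_cexp (hl.measurable 0).aemeasurable,
    integral_congr_ae (g := fun _ => (1 : ℂ))]
  · simp
  · filter_upwards [hl.zero] with ω hω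
    simp [hω]

lemma GSLF.IsLevyProcess.charFun_add (hl : IsLevyProcess l P) (s t : ℝ≥0) (ξ : ℝ) :
    charFun (P.map (l (s + t))) ξ = charFun (P.map (l s)) ξ * charFun (P.map (l t)) ξ := by
  have hst : s ≤ s + t := le_self_add
  have hind := hl.indep_increments.indepFun_eval_sub (zero_le : (0 : ℝ≥0) ≤ s) hst hl.zero
  have hid := (hl.stationary_increments s (s + t) hst).map_eq
  rw [add_tsub_cancel_left] at hid
  have h := hind.charFun_map_add_eq_mul (hl.measurable s).aemeasurable
    ((hl.measurable (s + t)).sub (hl.measurable s)).aemeasurable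
  rw [add_sub_cancel] at h
  rw [h, Pi.mul_apply, ← hid]
  rfl

lemma GSLF.IsLevyProcess.charFun_nsmul (hl : IsLevyProcess l P) (n : ℕ) (t : ℝ≥0) (ξ : ℝ) :
    charFun (P.map (l (n * t))) ξ = charFun (P.map (l t)) ξ ^ n := by
  induction n with
  | zero => simp [hl.charFun_zero]
  | succ n ih => rw [Nat.cast_succ, add_one_mul, hl.charFun_add, ih, pow_succ]

/-- Convergence in probability gives almost sure convergence along a subsequence, which is enough to
identify a limit already known to exist. -/
lemma GSLF.IsLevyProcess.exists_seq_tendsto_charFun (hl : IsLevyProcess l P) {u : ℕ → ℝ≥0} {s : ℝ≥0}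
    (hu : Tendsto u atTop (𝓝 s)) : ∃ ns : ℕ → ℕ, StrictMono ns ∧ ∀ ξ,
      Tendsto (fun n => charFun (P.map (l (u (ns n)))) ξ) atTop (𝓝 (charFun (P.map (l s)) ξ)) := by
  have h : TendstoInMeasure P (fun n => l (u n)) atTop (l s) :=
    (hl.stochastically_continuous s).comp hu
  obtain ⟨ns, hns, hlim⟩ := h.exists_seq_tendsto_ae
  refine ⟨ns, hns, fun ξ => ?_⟩
  have hc : Continuous fun y : ℝ => cexp (I * ξ * y) := by fun_prop
  simp_rw [charFun_map_eq_integral_cexp (hl.measurable _).aemeasurable]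
  refine tendsto_integral_of_dominated_convergence (fun _ => 1)
    (fun n => (hc.measurable.comp (hl.measurable _)).aestronglyMeasurable) (integrable_const _)
    (fun n => Eventually.of_forall fun ω => (norm_cexp_I_mul_mul _ _).le) ?_
  filter_upwards [hlim] with ω hω
  exact (hc.tendsto _).comp hω

/-- Taylor's bound for `|x| ≤ 1`; otherwise the left side is at most `2|x| ≤ 2x²`. -/
lemma norm_cexp_I_mul_sub_one_sub_le (x : ℝ) : ‖cexp (I * x) - 1 - I * x‖ ≤ 2 * x ^ 2 := by
  have hn : ‖I * (x : ℂ)‖ = |x| := by simp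
  rcases le_or_gt |x| 1 with h | h
  · have := norm_exp_sub_one_sub_id_le (x := I * x) (hn.trans_le h)
    rw [hn, sq_abs] at this
    nlinarith [sq_nonneg x]
  · have h1 := norm_sub_le (cexp (I * x) - 1) (I * x)
    have h2 := Real.norm_exp_I_mul_ofReal_sub_one_le (x := x)
    rw [Real.norm_eq_abs] at h2
    rw [← sq_abs]
    nlinarith

/-- Small jumps cost `2ξ²y²`, large jumps cost `2`. This is the domination that makes `ψ`
continuous. -/
lemma norm_levyIntegrand_le (ξ y : ℝ) :
    ‖cexp (I * ξ * y) - 1 - I * ξ * y * (if |y| ≤ 1 then 1 else 0)‖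
      ≤ (2 + 2 * ξ ^ 2) * min (y ^ 2) 1 := by
  have hx : I * (ξ : ℂ) * y = I * ((ξ * y : ℝ) : ℂ) := by push_cast; ring
  split_ifs with h
  · have hy : y ^ 2 ≤ 1 := by rw [← sq_abs]; exact pow_le_one₀ (abs_nonneg y) h
    rw [min_eq_left hy, mul_one, hx]
    refine (norm_cexp_I_mul_sub_one_sub_le _).trans ?_
    nlinarith [sq_nonneg y]
  · have hy : 1 ≤ y ^ 2 := by
      rw [← sq_abs]; exact one_le_pow₀ (not_le.1 h).le
    rw [min_eq_right hy, mul_zero, sub_zero]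
    calc _ ≤ ‖cexp (I * ξ * y)‖ + ‖(1 : ℂ)‖ := norm_sub_le _ _
      _ = 2 := by rw [norm_cexp_I_mul_mul, norm_one]; norm_num
      _ ≤ _ := by nlinarith [sq_nonneg ξ]

lemma continuous_charExponent (γ : ℝ) (b : ℝ≥0) {ν : Measure ℝ}
    (hν : Integrable (fun y : ℝ => min (y ^ 2) 1) ν) : Continuous (charExponent γ b ν) := by
  unfold charExponent
  refine Continuous.add (by fun_prop) (continuous_iff_continuousAt.2 fun ξ₀ => ?_)
  refine continuousAt_of_dominated (bound := fun y => (2 + 2 * (|ξ₀| + 1) ^ 2) * min (y ^ 2) 1)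
    (Eventually.of_forall fun ξ => ?_) ?_ (hν.restrict.const_mul _)
    (Eventually.of_forall fun y => ?_)
  · refine Measurable.aestronglyMeasurable ?_
    refine Measurable.sub (by fun_prop) (Measurable.mul (by fun_prop) ?_)
    exact Measurable.ite (measurableSet_le (by fun_prop) (by fun_prop)) measurable_const
      measurable_const
  · filter_upwards [Metric.ball_mem_nhds ξ₀ one_pos] with ξ hξ
    refine Eventually.of_forall fun y => (norm_levyIntegrand_le ξ y).trans ?_
    have h1 : |ξ| ≤ |ξ₀| + 1 := by
      have := abs_sub_abs_le_abs_sub ξ ξ₀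
      rw [Metric.mem_ball, Real.dist_eq] at hξ
      linarith
    rw [← sq_abs ξ]
    gcongr
  · fun_prop

lemma charExponent_zero (γ : ℝ) (b : ℝ≥0) (ν : Measure ℝ) : charExponent γ b ν 0 = 0 := by
  simp [charExponent]

/-- A continuous function on the line, all of whose values are `n`-th roots of unity, is constant. -/
lemma eq_of_continuous_of_pow_eq_one {r : ℝ → ℂ} (hr : Continuous r) {n : ℕ} (hn : 0 < n)
    (h : ∀ x, r x ^ n = 1) (x y : ℝ) : r x = r y := by
  have hfin : {z : ℂ | z ^ n = 1}.Finite := by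
    have := (Polynomial.nthRootsFinset n (1 : ℂ)).finite_toSet
    refine this.subset fun z hz => ?_
    simpa [Polynomial.mem_nthRootsFinset hn] using hz
  exact hfin.countable.isTotallyDisconnected (Set.range r)
    (by rintro _ ⟨x, rfl⟩; exact h x) (isPreconnected_range hr) ⟨x, rfl⟩ ⟨y, rfl⟩

lemma continuous_charFun (μ : Measure ℝ) [IsFiniteMeasure μ] : Continuous (charFun μ) := by
  have h : charFun μ = fun t : ℝ => ∫ x, cexp (t * x * I) ∂μ := funext charFun_apply_real
  rw [h]
  refine continuous_of_dominated (bound := fun _ => 1) (fun t => ?_) (fun t => ?_)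
    (integrable_const _) (Eventually.of_forall fun x => by fun_prop)
  · exact Continuous.aestronglyMeasurable (by fun_prop)
  · refine Eventually.of_forall fun x => ?_
    rw [← ofReal_mul, norm_exp_ofReal_mul_I]

/-- Times `1/(m+1)` come from taking roots, grid times from powers, and all other times from
stochastic continuity. -/
theorem GSLF.HasLevyTriplet.charFun_eq (hl : IsLevyProcess l P) {γ : ℝ} {b : ℝ≥0} {ν : Measure ℝ}
    (h : HasLevyTriplet l P γ b ν) (t : ℝ≥0) (ξ : ℝ) :
    charFun (P.map (l t)) ξ = cexp (t * charExponent γ b ν ξ) := by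
  have hprob : ∀ s, IsProbabilityMeasure (P.map (l s)) := fun s =>
    Measure.isProbabilityMeasure_map (hl.measurable s).aemeasurable
  have hψ := continuous_charExponent γ b h.levyMeasure
  have hroot : ∀ (m : ℕ) (ξ : ℝ), charFun (P.map (l (1 / (m + 1)))) ξ
      = cexp (charExponent γ b ν ξ / (m + 1)) := by
    intro m ξ
    have hm : (m : ℂ) + 1 ≠ 0 := Nat.cast_add_one_ne_zero m
    have hpow : ∀ ξ, charFun (P.map (l (1 / (m + 1)))) ξ ^ (m + 1)
        = cexp (charExponent γ b ν ξ) := by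
      intro ξ
      rw [← hl.charFun_nsmul, ← h.charFun_one]
      congr 3
      push_cast
      field_simp
    -- The right branch of the root: the quotient by `exp (ψ/(m+1))` is continuous in `ξ` with
    -- values in the roots of unity, hence constant, and it is `1` at `ξ = 0`.
    have hr := eq_of_continuous_of_pow_eq_one (n := m + 1)
      (r := fun ξ => charFun (P.map (l (1 / (m + 1)))) ξ * cexp (-(charExponent γ b ν ξ / (m + 1))))
      ?_ m.succ_pos ?_ ξ 0
    · simp only [charExponent_zero, MeasureTheory.charFun_zero, zero_div, neg_zero, exp_zero,
        mul_one, probReal_univ, ofReal_one, exp_neg] at hr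
      rwa [mul_inv_eq_one₀ (exp_ne_zero _)] at hr
    · have : Continuous (charFun (P.map (l (1 / (m + 1))))) := continuous_charFun _
      fun_prop
    · intro ξ
      rw [mul_pow, hpow, ← exp_nat_mul, ← exp_add]
      push_cast
      rw [mul_neg, mul_div_cancel₀ _ hm, add_neg_cancel, exp_zero]
  have hgrid : ∀ n, charFun (P.map (l (gridRight n t))) ξ
      = cexp (gridRight n t * charExponent γ b ν ξ) := by
    intro n
    have : gridRight n t = ((⌊((n : ℝ≥0) + 1) * t⌋₊ + 1 : ℕ) : ℝ≥0) * (1 / (n + 1)) := by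
      rw [gridRight]; push_cast; ring
    rw [this, hl.charFun_nsmul, hroot, ← exp_nat_mul]
    congr 1
    push_cast
    ring
  have ht : Tendsto (fun n => gridRight n t) atTop (𝓝 t) :=
    (tendsto_gridRight t).mono_right nhdsWithin_le_nhds
  obtain ⟨ns, hns, hlim⟩ := hl.exists_seq_tendsto_charFun ht
  refine tendsto_nhds_unique (hlim ξ) ?_
  simp_rw [hgrid]
  have hc : Continuous fun s : ℝ≥0 => cexp (s * charExponent γ b ν ξ) := by fun_prop
  exact (hc.tendsto t).comp (ht.comp hns.tendsto_atTop)

end Levy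

/-! ### Orthonormal expansions in Hilbert space -/

lemma MeasureTheory.MemLp.inner_toLp_eq_integral {α : Type*} [MeasurableSpace α] {μ : Measure α}
    {f g : α → ℝ} (hf : MemLp f 2 μ) (hg : MemLp g 2 μ) :
    inner ℝ (hf.toLp f) (hg.toLp g) = ∫ x, f x * g x ∂μ := by
  rw [L2.inner_def]
  refine integral_congr_ae ?_
  filter_upwards [hf.coeFn_toLp, hg.coeFn_toLp] with x hx hy
  rw [hx, hy, real_inner_eq_re_inner]
  simp [mul_comm]

section Hilbert

variable {H : Type*} [NormedAddCommGroup H] [InnerProductSpace ℝ H]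

lemma Orthonormal.norm_sq_sum_range_smul {z : ℕ → H} (hz : Orthonormal ℝ z) (a : ℕ → ℝ) (n : ℕ) :
    ‖∑ i ∈ Finset.range n, a i • z i‖ ^ 2 = ∑ i ∈ Finset.range n, a i ^ 2 := by
  rw [← real_inner_self_eq_norm_sq, hz.inner_sum]
  simp [sq]

/-- By Pythagoras the norms of the partial sums increase to `‖w‖`. -/
lemma Orthonormal.norm_sum_range_smul_le {z : ℕ → H} (hz : Orthonormal ℝ z) {a : ℕ → ℝ} {w : H}
    (h : Tendsto (fun n => ∑ i ∈ Finset.range n, a i • z i) atTop (𝓝 w)) (n : ℕ) :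
    ‖∑ i ∈ Finset.range n, a i • z i‖ ≤ ‖w‖ := by
  refine Monotone.ge_of_tendsto (f := fun n => ‖∑ i ∈ Finset.range n, a i • z i‖)
    (monotone_nat_of_le_succ fun n => ?_) h.norm n
  refine le_of_sq_le_sq ?_ (norm_nonneg _)
  rw [hz.norm_sq_sum_range_smul, hz.norm_sq_sum_range_smul, Finset.sum_range_succ]
  exact le_add_of_nonneg_right (sq_nonneg _)

/-- If the bounded family `w x` in a closed subspace `K` has the expansions `∑ c i * e i x • z i`,
with `z` orthonormal and `e` orthonormal in `L²`, then the vectors `c i • z i` lie in `K`. -/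
lemma smul_mem_of_orthonormal_expansion {D : Type*} [MeasurableSpace D] {μ : Measure D}
    [IsFiniteMeasure μ] {K : Submodule ℝ H} [K.HasOrthogonalProjection] {z : ℕ → H}
    (hz : Orthonormal ℝ z) {e : ℕ → D → ℝ} (he : ∀ i, MemLp (e i) 2 μ)
    (heo : Orthonormal ℝ fun i => (he i).toLp (e i)) {c : ℕ → ℝ} {w : D → H} (hwK : ∀ x, w x ∈ K)
    (hw : ∀ x, Tendsto (fun n => ∑ i ∈ Finset.range n, (c i * e i x) • z i) atTop (𝓝 (w x)))
    {M : ℝ} (hM : ∀ x, ‖w x‖ ≤ M) (i : ℕ) : c i • z i ∈ K := by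
  rw [← K.orthogonal_orthogonal, Submodule.mem_orthogonal]
  intro V hV
  -- `f n x` is the inner product of `V` with the `n`-th partial sum of `w x`, so it tends to `⟨V, w
  -- x⟩ = 0`.
  set f : ℕ → D → ℝ := fun n x => ∑ j ∈ Finset.range n, c j * inner ℝ V (z j) * e j x with hf
  have hfV : ∀ n x, f n x = inner ℝ V (∑ j ∈ Finset.range n, (c j * e j x) • z j) := by
    intro n x
    rw [inner_sum]
    refine Finset.sum_congr rfl fun j _ => ?_
    rw [inner_smul_right]
    ring
  have hee : ∀ j k, ∫ x, e j x * e k x ∂μ = if j = k then 1 else 0 := fun j k => by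
    rw [← (he j).inner_toLp_eq_integral (he k)]
    exact orthonormal_iff_ite.1 heo j k
  have hint : ∀ j, Integrable (fun x => e j x * e i x) μ := fun j => (he j).integrable_mul (he i)
  have hlim : Tendsto (fun n => ∫ x, f n x * e i x ∂μ) atTop (𝓝 (∫ _, (0 : ℝ) ∂μ)) := by
    refine tendsto_integral_of_dominated_convergence (fun x => ‖V‖ * M * |e i x|) (fun n => ?_)
      ?_ (fun n => ?_) ?_
    · refine AEStronglyMeasurable.mul ?_ (he i).1
      exact Finset.aestronglyMeasurable_fun_sum _ fun j _ => (he j).1.const_mul _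
    · exact (((he i).integrable (by norm_num)).abs).const_mul _
    · refine Eventually.of_forall fun x => ?_
      rw [norm_mul, hfV]
      refine mul_le_mul_of_nonneg_right ((norm_inner_le_norm _ _).trans ?_) (norm_nonneg _)
      exact mul_le_mul_of_nonneg_left ((hz.norm_sum_range_smul_le (hw x) n).trans (hM x))
        (norm_nonneg _)
    · refine Eventually.of_forall fun x => ?_
      have h := (tendsto_const_nhds (x := V)).inner (𝕜 := ℝ) (hw x)
      rw [Submodule.inner_left_of_mem_orthogonal (hwK x) hV] at h
      simp_rw [hfV]
      simpa using h.mul_const (e i x)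
  -- Orthonormality of `e` isolates the `i`-th coefficient, so the integrals are eventually constant
  -- while tending to `0`.
  have hval : ∀ n, i < n → ∫ x, f n x * e i x ∂μ = c i * inner ℝ V (z i) := by
    intro n hn
    simp_rw [hf, Finset.sum_mul, mul_assoc]
    rw [integral_finsetSum _ fun j _ => ((hint j).const_mul _).const_mul _]
    simp_rw [integral_const_mul, hee]
    simp [hn]
  rw [inner_smul_right]
  refine tendsto_nhds_unique (f := fun n => ∫ x, f n x * e i x ∂μ) (l := atTop)
    (tendsto_const_nhds.congr' ?_) (by simpa using hlim)
  filter_upwards [eventually_gt_atTop i] with n hn using (hval n hn).symm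

end Hilbert

/-! ### The truncated Karhunen–Loève expansion -/

section KarhunenLoeve

variable {Ω : Type*} [MeasurableSpace Ω] {P : Measure Ω}
  {d : ℕ} {D : Set (EuclideanSpace ℝ (Fin d))} {W : D → Ω → ℝ} {lam : ℕ → ℝ} {e : ℕ → D → ℝ}
  {Z : ℕ → Ω → ℝ}

lemma GSLF.IsGaussianField.memLp (hW : IsGaussianField W P) (x : D) : MemLp (W x) 2 P :=
  (hW.gaussian.hasGaussianLaw_eval x).memLp_two

lemma memLp_of_map_eq_gaussianReal {X : Ω → ℝ} (hX : Measurable X)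
    (h : P.map X = gaussianReal 0 1) : MemLp X 2 P := by
  have := memLp_id_gaussianReal (μ := 0) (v := 1) 2
  rw [← h] at this
  exact (memLp_map_measure_iff this.1 hX.aemeasurable).1 this

lemma GSLF.IsKarhunenLoeve.memLp (hK : IsKarhunenLoeve W P lam e Z) (i : ℕ) : MemLp (Z i) 2 P :=
  memLp_of_map_eq_gaussianReal (hK.measurable i) (hK.law i)

lemma measurable_klSum (hZ : ∀ i, Measurable (Z i)) (N : ℕ) (x : D) :
    Measurable (klSum lam e Z N x) :=
  Finset.measurable_fun_sum _ fun i _ => ((hZ i).const_mul _).mul_const _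

lemma memLp_klSum (hZ : ∀ i, MemLp (Z i) 2 P) (N : ℕ) (x : D) :
    MemLp (klSum lam e Z N x) 2 P :=
  memLp_finsetSum _ fun i _ => ((hZ i).const_mul _).mul_const _

lemma measurable_truncKL (hZ : ∀ i, Measurable (Z i)) (N : ℕ) (x : D) :
    Measurable (truncKL W P lam e Z N x) := (measurable_klSum hZ N x).const_add _

lemma GSLF.IsCovEigenbasis.klVar_eq (h : IsCovEigenbasis W P lam e) (N : ℕ) (x : D) :
    klVar lam e N x = ∑ i ∈ Finset.range N, (√(lam i) * e i x) ^ 2 :=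
  Finset.sum_congr rfl fun i _ => by rw [mul_pow, Real.sq_sqrt (h.nonneg i)]

lemma GSLF.IsKarhunenLoeve.klVar_nonneg (hK : IsKarhunenLoeve W P lam e Z) (N : ℕ) (x : D) :
    0 ≤ klVar lam e N x :=
  Finset.sum_nonneg fun i _ => mul_nonneg (hK.eigenbasis.nonneg i) (sq_nonneg _)

lemma GSLF.IsKarhunenLoeve.orthonormal (hK : IsKarhunenLoeve W P lam e Z) :
    Orthonormal ℝ fun i => (hK.memLp i).toLp (Z i) := by
  have hmean : ∀ i, ∫ ω, Z i ω ∂P = 0 := fun i => by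
    rw [← integral_map (f := fun y : ℝ => y) (hK.measurable i).aemeasurable (by fun_prop), hK.law,
      integral_id_gaussianReal]
  rw [orthonormal_iff_ite]
  intro i j
  rw [(hK.memLp i).inner_toLp_eq_integral]
  split_ifs with h
  · subst h
    have hv : Var[Z i; P] = 1 := by
      have := variance_fun_id_gaussianReal (μ := 0) (v := 1)
      rw [← hK.law i, variance_map (by fun_prop) (hK.measurable i).aemeasurable] at this
      exact this
    rw [variance_of_integral_eq_zero (hK.measurable i).aemeasurable (hmean i)] at hv
    simpa [sq] using hv
  · rw [(hK.indep.indepFun h).integral_fun_mul_eq_mul_integral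
      (hK.measurable i).aestronglyMeasurable (hK.measurable j).aestronglyMeasurable, hmean, zero_mul]

lemma toLp_klSum (hZ : ∀ i, MemLp (Z i) 2 P) (N : ℕ) (x : D) :
    (memLp_klSum (lam := lam) (e := e) hZ N x).toLp (klSum lam e Z N x)
      = ∑ i ∈ Finset.range N, (√(lam i) * e i x) • (hZ i).toLp (Z i) := by
  induction N with
  | zero =>
    rw [Finset.sum_range_zero, ← MemLp.toLp_zero (MemLp.zero (p := 2) (μ := P) (ε := ℝ))]
    exact MemLp.toLp_congr _ _ (Eventually.of_forall fun ω => by simp [klSum])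
  | succ N ih =>
    rw [Finset.sum_range_succ, ← ih, ← MemLp.toLp_const_smul, ← MemLp.toLp_add]
    refine MemLp.toLp_congr _ _ (Eventually.of_forall fun ω => ?_)
    simp only [klSum, Finset.sum_range_succ, Pi.add_apply, Pi.smul_apply, smul_eq_mul]
    ring

lemma GSLF.IsKarhunenLoeve.integral_klSum_sq (hK : IsKarhunenLoeve W P lam e Z) (N : ℕ) (x : D) :
    ∫ ω, klSum lam e Z N x ω ^ 2 ∂P = klVar lam e N x := by
  rw [hK.eigenbasis.klVar_eq, ← hK.orthonormal.norm_sq_sum_range_smul, ← toLp_klSum,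
    ← real_inner_self_eq_norm_sq, MemLp.inner_toLp_eq_integral]
  simp_rw [sq]

variable [IsProbabilityMeasure P]

/-- The truncated expansion is normally distributed. -/
theorem GSLF.IsKarhunenLoeve.map_truncKL (hK : IsKarhunenLoeve W P lam e Z) (N : ℕ) (x : D) :
    P.map (truncKL W P lam e Z N x)
      = gaussianReal (meanFun W P x) (klVar lam e N x).toNNReal := by
  have hm := measurable_klSum (lam := lam) (e := e) hK.measurable N x
  have hS : P.map (klSum lam e Z N x) = gaussianReal 0 (klVar lam e N x).toNNReal := by
    have := Measure.isProbabilityMeasure_map (μ := P) hm.aemeasurable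
    refine Measure.ext_of_charFun (funext fun ξ => ?_)
    -- Independence factors the characteristic function into Gaussian ones, whose exponents add up
    -- to the variance.
    have hind : iIndepFun (fun i ω => (√(lam i) * e i x) * Z i ω) P :=
      hK.indep.comp (fun i y => (√(lam i) * e i x) * y) fun i => by fun_prop
    have hk : klSum lam e Z N x = fun ω => ∑ i ∈ Finset.range N, (√(lam i) * e i x) * Z i ω := by
      funext ω
      exact Finset.sum_congr rfl fun i _ => by ring
    rw [hk, (hind.restrict _).charFun_map_fun_finsetSum_eq_prod
      fun i _ => ((hK.measurable i).const_mul _).aemeasurable, Finset.prod_apply,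
      charFun_gaussianReal]
    simp_rw [charFun_map_mul_comp (hK.measurable _).aemeasurable, hK.law, charFun_gaussianReal]
    rw [← exp_sum, Real.coe_toNNReal _ (hK.klVar_nonneg N x), hK.eigenbasis.klVar_eq]
    congr 1
    push_cast
    simp only [mul_zero, zero_mul, zero_sub, Finset.sum_neg_distrib, Finset.sum_mul,
      Finset.sum_div]
    congr 1
    exact Finset.sum_congr rfl fun i _ => by ring
  have hcomp : truncKL W P lam e Z N x = (fun y => meanFun W P x + y) ∘ klSum lam e Z N x := rfl
  rw [hcomp, ← Measure.map_map (by fun_prop) hm, hS, gaussianReal_map_const_add, zero_add]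

lemma GSLF.IsKarhunenLoeve.variance_truncKL (hK : IsKarhunenLoeve W P lam e Z) (N : ℕ) (x : D) :
    Var[truncKL W P lam e Z N x; P] = klVar lam e N x := by
  have := variance_fun_id_gaussianReal (μ := meanFun W P x) (v := (klVar lam e N x).toNNReal)
  rw [← hK.map_truncKL, variance_map (by fun_prop)
    (measurable_truncKL hK.measurable N x).aemeasurable,
    Real.coe_toNNReal _ (hK.klVar_nonneg N x)] at this
  exact this

lemma memLp_centered (hW : ∀ x, MemLp (W x) 2 P) (x : D) :
    MemLp (fun ω => W x ω - meanFun W P x) 2 P := (hW x).sub (memLp_const _)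

lemma GSLF.IsKarhunenLoeve.tendsto_sum (hK : IsKarhunenLoeve W P lam e Z)
    (hW : ∀ x, MemLp (W x) 2 P) (x : D) :
    Tendsto (fun n => ∑ i ∈ Finset.range n, (√(lam i) * e i x) • (hK.memLp i).toLp (Z i)) atTop
      (𝓝 ((memLp_centered hW x).toLp _)) := by
  simp_rw [← toLp_klSum]
  rw [Lp.tendsto_Lp_iff_tendsto_eLpNorm'' _ (fun n => memLp_klSum hK.memLp n x) _
    (memLp_centered hW x)]
  refine (hK.expansion x).congr fun n => ?_
  rw [← eLpNorm_neg]
  congr 1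
  funext ω
  simp only [Pi.neg_apply, Pi.sub_apply]
  ring

lemma GSLF.IsMeanSquareContinuous.continuous_centered (hc : IsMeanSquareContinuous W P)
    (hW : ∀ x, MemLp (W x) 2 P) : Continuous fun x => (memLp_centered hW x).toLp _ := by
  have hv : Continuous fun x => (hW x).toLp (W x) := by
    refine continuous_iff_continuousAt.2 fun x => ?_
    exact (Lp.tendsto_Lp_iff_tendsto_eLpNorm'' _ hW _ (hW x)).2 (hc x)
  have ho : MemLp (fun _ : Ω => (1 : ℝ)) 2 P := memLp_const 1
  -- The mean is the inner product with the constant `1`, so centring is a continuous operation on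
  -- `L²(P)`.
  have heq : ∀ x, (memLp_centered hW x).toLp _
      = (hW x).toLp (W x) - (inner ℝ (ho.toLp _) ((hW x).toLp (W x))) • ho.toLp _ := by
    intro x
    rw [ho.inner_toLp_eq_integral, ← MemLp.toLp_const_smul, ← MemLp.toLp_sub]
    refine MemLp.toLp_congr _ _ (Eventually.of_forall fun ω => ?_)
    simp [meanFun]
  simp_rw [heq]
  fun_prop

lemma isFiniteMeasure_volOn (hD : IsCompact D) : IsFiniteMeasure (volOn D) := by
  refine ⟨?_⟩
  rw [(MeasurableEmbedding.subtype_coe hD.measurableSet).comap_apply]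
  simpa using hD.measure_lt_top

/-- The terms of the Karhunen–Loève expansion are, up to null sets, functions of the field. -/
theorem GSLF.IsKarhunenLoeve.aestronglyMeasurable_sqrt_mul (hK : IsKarhunenLoeve W P lam e Z)
    (hW : IsGaussianField W P) (hD : IsCompact D) (hc : IsMeanSquareContinuous W P) (i : ℕ) :
    AEStronglyMeasurable[MeasurableSpace.comap (fun ω x => W x ω) inferInstance]
      (fun ω => √(lam i) * Z i ω) P := by
  have hm : MeasurableSpace.comap (fun ω x => W x ω) inferInstance ≤ ‹MeasurableSpace Ω› :=
    (measurable_pi_lambda _ hW.measurable).comap_le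
  have := isFiniteMeasure_volOn hD
  have : Fact (MeasurableSpace.comap (fun ω x => W x ω) inferInstance ≤ ‹MeasurableSpace Ω›) := ⟨hm⟩
  have : CompactSpace D := isCompact_iff_compactSpace.1 hD
  -- Compactness of `D` and mean-square continuity supply the uniform bound needed for domination.
  obtain ⟨M, hM⟩ := (isCompact_range (hc.continuous_centered hW.memLp)).isBounded.exists_norm_le
  -- `K` is the closed subspace of variables measurable, up to null sets, with respect to the field.
  have hmem := smul_mem_of_orthonormal_expansion
    (K := lpMeas ℝ ℝ (MeasurableSpace.comap (fun ω x => W x ω) inferInstance) 2 P)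
    hK.orthonormal hK.eigenbasis.memLp hK.eigenbasis.orthonormal
    (w := fun x => (memLp_centered hW.memLp x).toLp _) (fun x => ?_) (hK.tendsto_sum hW.memLp)
    (fun x => hM _ ⟨x, rfl⟩) i
  · rw [mem_lpMeas_iff_aestronglyMeasurable, ← MemLp.toLp_const_smul] at hmem
    exact hmem.congr (MemLp.coeFn_toLp _)
  · rw [mem_lpMeas_iff_aestronglyMeasurable]
    refine AEStronglyMeasurable.congr ?_ (MemLp.coeFn_toLp _).symm
    refine (Measurable.stronglyMeasurable ?_).aestronglyMeasurable
    refine Measurable.sub_const ?_ _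
    exact (measurable_pi_apply (X := fun _ : D => ℝ) x).comp (comap_measurable _)

/-- A process independent of the field is independent of its truncated expansions. -/
theorem GSLF.IsKarhunenLoeve.indepFun_truncKL (hK : IsKarhunenLoeve W P lam e Z)
    (hW : IsGaussianField W P) (hD : IsCompact D) (hc : IsMeanSquareContinuous W P)
    {β : Type*} [MeasurableSpace β] {X : Ω → β} (hX : IndepFun X (fun ω x => W x ω) P)
    (N : ℕ) (x : D) : IndepFun X (truncKL W P lam e Z N x) P := by
  -- `g i` is a field-measurable version of `√λ_i Z_i`. The factor matters: if `λ_i = 0`, the field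
  -- carries no information on `Z_i` through this term.
  choose g hg hgeq using hK.aestronglyMeasurable_sqrt_mul hW hD hc
  have hm : Measurable[MeasurableSpace.comap (fun ω x => W x ω) inferInstance]
      fun ω => meanFun W P x + ∑ i ∈ Finset.range N, g i ω * e i x :=
    (Finset.measurable_fun_sum _ fun i _ => (hg i).measurable.mul_const _).const_add _
  refine IndepFun.congr (g := fun ω => meanFun W P x + ∑ i ∈ Finset.range N, g i ω * e i x)
    ?_ EventuallyEq.rfl ?_
  · rw [IndepFun_iff_Indep] at hX ⊢
    exact indep_of_indep_of_le_right hX hm.comap_le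
  · filter_upwards [ae_all_iff.2 hgeq] with ω hω
    simp only [truncKL, klSum, hω]

end KarhunenLoeve

/-! ### Piecewise constant interpolation on a grid -/

section PiecewiseConst

variable {Ω : Type*} {l : ℝ≥0 → Ω → ℝ} {t : ℕ → ℝ≥0} {n : ℕ}

lemma continuousWithinAt_Ioi_indicator_Ico_const (a b c' : ℝ≥0) (c : ℝ) :
    ContinuousWithinAt ((Set.Ico a b).indicator fun _ => c) (Set.Ioi c') c' := by
  by_cases h : c' ∈ Set.Ico a b
  · refine (continuousWithinAt_const (b := c)).congr_of_eventuallyEq ?_ (by simp [h])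
    filter_upwards [self_mem_nhdsWithin, mem_nhdsWithin_of_mem_nhds (Iio_mem_nhds h.2)] with x hx hx'
    have hmem : x ∈ Set.Ico a b := ⟨h.1.trans (le_of_lt hx), hx'⟩
    rw [Set.indicator_of_mem hmem]
  · refine (continuousWithinAt_const (b := (0 : ℝ))).congr_of_eventuallyEq ?_ (by simp [h])
    rcases lt_or_ge c' a with ha | ha
    · filter_upwards [mem_nhdsWithin_of_mem_nhds (Iio_mem_nhds ha)] with x hx
      exact Set.indicator_of_notMem (fun hx' => (not_le.2 hx) hx'.1) _
    · filter_upwards [self_mem_nhdsWithin] with x hx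
      exact Set.indicator_of_notMem (fun hx' => h ⟨ha, lt_trans hx hx'.2⟩) _

lemma continuousWithinAt_Ioi_piecewiseConst (s : ℝ≥0) (ω : Ω) :
    ContinuousWithinAt (fun s => piecewiseConst l t n s ω) (Set.Ioi s) s :=
  tendsto_finsetSum _ fun _ _ => continuousWithinAt_Ioi_indicator_Ico_const _ _ _ _

/-- The interpolated path is a measurable function of the whole path of `l`, so it inherits
independence. -/
lemma measurable_sum_indicator_eval (t : ℕ → ℝ≥0) (n : ℕ) :
    Measurable fun (p : ℝ≥0 → ℝ) (s : ℝ≥0) =>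
      ∑ i ∈ Finset.range n, (Set.Ico (t i) (t (i + 1))).indicator (fun _ => p (t i)) s := by
  refine measurable_pi_lambda _ fun s => Finset.measurable_fun_sum _ fun i _ => ?_
  by_cases h : s ∈ Set.Ico (t i) (t (i + 1))
  · simpa only [Set.indicator_of_mem h] using measurable_pi_apply (t i)
  · simpa only [Set.indicator_of_notMem h] using measurable_const

lemma measurable_piecewiseConst [MeasurableSpace Ω] (hl : ∀ s, Measurable (l s)) (s : ℝ≥0) :
    Measurable (piecewiseConst l t n s) :=
  (measurable_pi_apply s).comp
    ((measurable_sum_indicator_eval t n).comp (measurable_pi_lambda (fun ω s => l s ω) hl))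

variable {ε : ℝ≥0}

lemma eq_mul_of_uniform_grid (h0 : t 0 = 0) (hstep : ∀ i < n, t (i + 1) = t i + ε) {i : ℕ}
    (hi : i ≤ n) : t i = i * ε := by
  induction i with
  | zero => simp [h0]
  | succ i ih =>
    rw [hstep i hi, ih (Nat.le_of_succ_le hi)]
    push_cast
    ring

lemma floor_div_lt_of_uniform_grid (hε : 0 < ε) (h0 : t 0 = 0)
    (hstep : ∀ i < n, t (i + 1) = t i + ε) {s : ℝ≥0} (hs : s < t n) : ⌊s / ε⌋₊ < n := by
  rw [Nat.floor_lt zero_le, div_lt_iff₀ hε, ← eq_mul_of_uniform_grid h0 hstep le_rfl]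
  exact hs

/-- The cells are `[iε, (i+1)ε)`, and `s` lies in the one with `i = ⌊s/ε⌋`. The bound `s < t n` is
needed since the sum vanishes beyond the grid. -/
lemma piecewiseConst_of_uniform_grid (hε : 0 < ε) (h0 : t 0 = 0)
    (hstep : ∀ i < n, t (i + 1) = t i + ε) {s : ℝ≥0} (hs : s < t n) :
    piecewiseConst l t n s = l (t ⌊s / ε⌋₊) := by
  funext ω
  have hk := floor_div_lt_of_uniform_grid hε h0 hstep hs
  have hmem : ∀ i < n, s ∈ Set.Ico (t i) (t (i + 1)) ↔ ⌊s / ε⌋₊ = i := by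
    intro i hi
    rw [eq_mul_of_uniform_grid h0 hstep hi.le, eq_mul_of_uniform_grid h0 hstep hi, Set.mem_Ico,
      Nat.floor_eq_iff zero_le, le_div_iff₀ hε, div_lt_iff₀ hε]
    push_cast
    rfl
  rw [piecewiseConst, Finset.sum_eq_single ⌊s / ε⌋₊, Set.indicator_of_mem ((hmem _ hk).2 rfl)]
  · intro i hi hne
    exact Set.indicator_of_notMem (fun h => hne ((hmem i (Finset.mem_range.1 hi)).1 h).symm) _
  · exact fun h => absurd (Finset.mem_range.2 hk) h

end PiecewiseConst

/-! ### The main theorem -/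

theorem mainTheorem3 {Ω : Type*} [MeasurableSpace Ω] (P : Measure Ω) [IsProbabilityMeasure P]
    {d : ℕ} (D : Set (EuclideanSpace ℝ (Fin d)))
    (l : ℝ≥0 → Ω → ℝ) (hl : IsLevyProcess l P)
    (W : D → Ω → ℝ) (hW : IsGaussianField W P) (hlW : IndepFamilies l W P)
    (F : ℝ → ℝ≥0) (hF : Measurable F) :
    -- arbitrary càdlàg approximation of `l` (on `[0, C)`, `C ≤ ∞`), arbitrary approximation of `W`
    (∀ (C : ℝ≥0∞) (lε : ℝ≥0 → Ω → ℝ) (WN : D → Ω → ℝ),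
      (∀ y, (F y : ℝ≥0∞) < C) →
      (∀ t, Measurable (lε t)) → (∀ᵐ ω ∂P, IsCadlagBefore C (fun t => lε t ω)) →
      (∀ x, Measurable (WN x)) → IndepFamilies lε WN P →
      ∀ x : D,
        AEMeasurable (subordField lε F WN x) P ∧
        ∀ ξ : ℝ,
          Integrable (fun ω => charFun (P.map (lε (F (WN x ω)))) ξ) P ∧
          charFun (P.map (subordField lε F WN x)) ξ
            = ∫ ω, cexp (I * ξ * subordField lε F WN x ω) ∂P ∧
          ∫ ω, cexp (I * ξ * subordField lε F WN x ω) ∂P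
            = ∫ ω, charFun (P.map (lε (F (WN x ω)))) ξ ∂P) ∧
    -- piecewise constant approximation of `l`, truncated Karhunen–Loève approximation of `W`
    (∀ (γ : ℝ) (b : ℝ≥0) (ν : Measure ℝ), HasLevyTriplet l P γ b ν →
      IsCompact D → IsMeanSquareContinuous W P →
      ∀ (lam : ℕ → ℝ) (e : ℕ → D → ℝ) (Z : ℕ → Ω → ℝ), IsKarhunenLoeve W P lam e Z →
      ∀ (CF ε : ℝ≥0) (t : ℕ → ℝ≥0) (Nl : ℕ),
      (∀ y, F y < CF) → 0 < ε →
      t 0 = 0 → t Nl = CF → (∀ i < Nl, t (i + 1) = t i + ε) →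
      ∀ (N : ℕ) (x : D),
        Var[truncKL W P lam e Z N x; P] = ∫ ω, klSum lam e Z N x ω ^ 2 ∂P ∧
        ∫ ω, klSum lam e Z N x ω ^ 2 ∂P = klVar lam e N x ∧
        AEMeasurable (subordField (piecewiseConst l t Nl) F (truncKL W P lam e Z N) x) P ∧
        ∀ ξ : ℝ,
          charFun (P.map (subordField (piecewiseConst l t Nl) F (truncKL W P lam e Z N) x)) ξ
            = ∫ ω, charFun
                (P.map (piecewiseConst l t Nl (F (truncKL W P lam e Z N x ω)))) ξ ∂P ∧
          Integrable (fun y => cexp ((t ⌊F y / ε⌋₊ : ℂ) * charExponent γ b ν ξ))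
            (gaussianReal (meanFun W P x) (klVar lam e N x).toNNReal) ∧
          charFun (P.map (subordField (piecewiseConst l t Nl) F (truncKL W P lam e Z N) x)) ξ
            = ∫ y, cexp ((t ⌊F y / ε⌋₊ : ℂ) * charExponent γ b ν ξ)
                ∂(gaussianReal (meanFun W P x) (klVar lam e N x).toNNReal) ∧
          (0 < klVar lam e N x →
            charFun (P.map (subordField (piecewiseConst l t Nl) F (truncKL W P lam e Z N) x)) ξ
              = ((1 / √(2 * Real.pi * klVar lam e N x) : ℝ) : ℂ)
                * ∫ y : ℝ, cexp ((t ⌊F y / ε⌋₊ : ℂ) * charExponent γ b ν ξ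
                    - (((y - meanFun W P x) ^ 2 / (2 * klVar lam e N x) : ℝ) : ℂ)))) := by
  refine ⟨fun C lε WN hFC hlε hcad hWN hind x => ?_, fun γ b ν hν hD hc lam e Z hK CF ε t Nl hFC hε
    h0 hCF hstep N x => ⟨(hK.variance_truncKL N x).trans (hK.integral_klSum_sq N x).symm,
      hK.integral_klSum_sq N x, ?_⟩⟩
  · have hT : Measurable fun ω => F (WN x ω) := hF.comp (hWN x)
    obtain ⟨h1, h2⟩ := charFun_randomTime hlε hT
      -- Since `F < C`, right-continuity is available at every value of the random time.
      (hind.comp measurable_id (hF.comp (measurable_pi_apply x)))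
      (hcad.mono fun ω hω ω' => (hω _ (hFC _)).1)
    exact ⟨h1, fun ξ => ⟨(h2 ξ).1, charFun_map_eq_integral_cexp h1 ξ, (h2 ξ).2⟩⟩
  · have hY := measurable_truncKL (W := W) (P := P) (lam := lam) (e := e) hK.measurable N x
    have hT : Measurable fun ω => F (truncKL W P lam e Z N x ω) := hF.comp hY
    obtain ⟨h1, h2⟩ := charFun_randomTime (measurable_piecewiseConst (t := t) (n := Nl) hl.measurable)
      hT ((hK.indepFun_truncKL hW hD hc hlW N x).comp (measurable_sum_indicator_eval t Nl) hF)
      (Eventually.of_forall fun ω ω' => continuousWithinAt_Ioi_piecewiseConst _ _)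
    refine ⟨h1, fun ξ => ?_⟩
    have hφ : ∀ y, charFun (P.map (piecewiseConst l t Nl (F y))) ξ
        = cexp ((t ⌊F y / ε⌋₊ : ℂ) * charExponent γ b ν ξ) := fun y => by
      rw [piecewiseConst_of_uniform_grid hε h0 hstep (hCF ▸ hFC y), hν.charFun_eq hl]
    have hg : Measurable fun y => cexp ((t ⌊F y / ε⌋₊ : ℂ) * charExponent γ b ν ξ) :=
      (measurable_from_nat (f := fun k => cexp ((t k : ℂ) * charExponent γ b ν ξ))).comp
        (Nat.measurable_floor.comp (hF.div_const ε))
    have hmix := (charFun_map_eq_integral_cexp h1 ξ).trans (h2 ξ).2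
    have hgauss : charFun (P.map (subordField (piecewiseConst l t Nl) F
        (truncKL W P lam e Z N) x)) ξ = ∫ y, cexp ((t ⌊F y / ε⌋₊ : ℂ) * charExponent γ b ν ξ)
          ∂(gaussianReal (meanFun W P x) (klVar lam e N x).toNNReal) := by
      rw [← hK.map_truncKL, integral_map hY.aemeasurable hg.aestronglyMeasurable]
      simp_rw [← hφ]
      exact hmix
    refine ⟨hmix, ?_, hgauss, fun hpos => ?_⟩
    -- The bound `1` holds because the integrand is a characteristic function, with no appeal to the
    -- sign of `Re ψ`.
    · refine Integrable.of_bound hg.aestronglyMeasurable 1 (Eventually.of_forall fun y => ?_)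
      have := Measure.isProbabilityMeasure_map (μ := P)
        (measurable_piecewiseConst (t := t) (n := Nl) hl.measurable (F y)).aemeasurable
      rw [← hφ]
      exact norm_charFun_le_one ξ
    · rw [hgauss, integral_gaussianReal_eq_integral_smul (by simpa using hpos),
        ← integral_const_mul]
      refine integral_congr_ae (Eventually.of_forall fun y => ?_)
      dsimp only
      rw [gaussianPDFReal, Real.coe_toNNReal _ hpos.le, real_smul, sub_eq_add_neg (_ * _),
        exp_add, ofReal_mul, neg_div, ofReal_exp, ofReal_neg, one_div]
      ring
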